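/- Let $(M,g)$ be a 5-dimensional smooth Riemannian manifold with Levi-Civita connection $\nabla$, and let $R(X,Y)Z=[\nabla_X,\nabla_Y]Z-\nabla_{[X,Y]}Z$ be its curvature tensor. At a point of $M$ fix an orthonormal basis $e_1,\dots,e_5$ of the tangent space, and put $g_{ij}=g(e_i,e_j)=\delta_{ij}$ and $R_{abcd}=g(R(e_a,e_b)e_c,e_d)$. Repeated indices are summed from $1$ to $5$. Let $\rho_{ij}=R_{aija}$ be the Ricci tensor, $\tau=\rho_{ii}$ the scalar curvature, $|R|^2=R_{abcd}R_{abcd}$, and $$\check R_{ij}=R_{iuvj}R_{abcu}R_{abcv},\qquad \hat R_{ij}=R_{ibac}R_{jbuv}R_{acuv},\qquad \mathring R_{ij}=R_{iabc}R_{jubv}R_{aucv}.$$ If $M$ is an Einstein manifold, i.e. $\rho=c\,g$ on $M$ for some constant $c\in\mathbb{R}$, then at every point of $M$, with respect to every orthonormal basis of the tangent space and for all $i,j\in\{1,\dots,5\}$, $$\Big(\frac{\tau^3}{25}+\frac{\tau}{5}|R|^2\Big)g_{ij}-2\tau R_{iabc}R_{jabc}-4\check R_{ij}-4\hat R_{ij}+8\mathring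 R_{ij}=0.$$ -/

import Mathlib

open Bundle Manifold ContDiff

namespace RiemGeom

noncomputable section LeviCivita

variable {E : Type*} [NormedAddCommGroup E] [NormedSpace ℝ E]
  {H : Type*} [TopologicalSpace H] (I : ModelWithCorners ℝ E H)
  {M : Type*} [TopologicalSpace M] [ChartedSpace H M]
  [RiemannianBundle (fun x : M ↦ TangentSpace I x)]

/-- The right-hand side of the Koszul formula
`2 g(∇_X Y, Z) = X g(Y,Z) + Y g(X,Z) - Z g(X,Y) + g([X,Y],Z) - g([X,Z],Y) - g([Y,Z],X)`. -/
def koszul (X Y Z : Π x : M, TangentSpace I x) (x : M) : ℝ :=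
  mvfderiv I (fun y ↦ inner ℝ (Y y) (Z y)) x (X x)
    + mvfderiv I (fun y ↦ inner ℝ (X y) (Z y)) x (Y x)
    - mvfderiv I (fun y ↦ inner ℝ (X y) (Y y)) x (Z x)
    + inner ℝ (VectorField.mlieBracket I X Y x) (Z x)
    - inner ℝ (VectorField.mlieBracket I X Z x) (Y x)
    - inner ℝ (VectorField.mlieBracket I Y Z x) (X x)

variable {I} in
theorem koszul_add_swap_right (X Y Z : Π x : M, TangentSpace I x) (x : M) :
    koszul I X Y Z x + koszul I X Z Y x =
      2 * mvfderiv I (fun y ↦ (inner ℝ (Y y) (Z y) : ℝ)) x (X x) := by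
  have h : (fun y ↦ (inner ℝ (Z y) (Y y) : ℝ)) = fun y ↦ inner ℝ (Y y) (Z y) := by
    ext y; exact real_inner_comm _ _
  unfold koszul
  rw [h, VectorField.mlieBracket_swap_apply (V := Z) (W := Y), inner_neg_left]
  ring

variable {I} in
theorem koszul_sub_swap_left (X Y Z : Π x : M, TangentSpace I x) (x : M) :
    koszul I X Y Z x - koszul I Y X Z x =
      2 * inner ℝ (VectorField.mlieBracket I X Y x) (Z x) := by
  have h : (fun y ↦ (inner ℝ (Y y) (X y) : ℝ)) = fun y ↦ inner ℝ (X y) (Y y) := by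
    ext y; exact real_inner_comm _ _
  unfold koszul
  rw [h, VectorField.mlieBracket_swap_apply (V := Y) (W := X), inner_neg_left]
  ring

section

variable {I} [IsManifold I ∞ M] [IsContMDiffRiemannianBundle I ∞ E (fun x : M ↦ TangentSpace I x)]

theorem mdifferentiableAt_inner {Y Z : Π x : M, TangentSpace I x} {x : M}
    (hY : MDiffAt (T% Y) x) (hZ : MDiffAt (T% Z) x) :
    MDiffAt (fun y ↦ (inner ℝ (Y y) (Z y) : ℝ)) x :=
  MDifferentiableAt.inner_bundle (E := fun x : M ↦ TangentSpace I x) (F := E) (IB := I)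
    (b := fun x : M ↦ x) (v := Y) (w := Z) (x := x) (IM := I) hY hZ

theorem mvfderiv_inner_add {X X' Y : Π x : M, TangentSpace I x} {x : M}
    (hX : MDiffAt (T% X) x) (hX' : MDiffAt (T% X') x) (hY : MDiffAt (T% Y) x)
    (v : TangentSpace I x) :
    mvfderiv I (fun y ↦ (inner ℝ ((X + X') y) (Y y) : ℝ)) x v =
      mvfderiv I (fun y ↦ (inner ℝ (X y) (Y y) : ℝ)) x v
        + mvfderiv I (fun y ↦ (inner ℝ (X' y) (Y y) : ℝ)) x v := by
  simp only [Pi.add_apply, inner_add_left]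
  rw [mvfderiv_fun_add (mdifferentiableAt_inner hX hY) (mdifferentiableAt_inner hX' hY)]
  rfl

theorem mvfderiv_inner_smul {f : M → ℝ} {X Y : Π x : M, TangentSpace I x} {x : M}
    (hf : MDiffAt f x) (hX : MDiffAt (T% X) x) (hY : MDiffAt (T% Y) x)
    (v : TangentSpace I x) :
    mvfderiv I (fun y ↦ (inner ℝ ((f • X) y) (Y y) : ℝ)) x v =
      f x * mvfderiv I (fun y ↦ (inner ℝ (X y) (Y y) : ℝ)) x v
        + mvfderiv I f x v * inner ℝ (X x) (Y x) := by
  simp only [Pi.smul_apply', real_inner_smul_left]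
  rw [mvfderiv_fun_mul hf (mdifferentiableAt_inner hX hY)]
  simp [mul_comm]

variable [FiniteDimensional ℝ E]

theorem koszul_add_left {X X' Y Z : Π x : M, TangentSpace I x} {x : M}
    (hX : MDiffAt (T% X) x) (hX' : MDiffAt (T% X') x)
    (hY : MDiffAt (T% Y) x) (hZ : MDiffAt (T% Z) x) :
    koszul I (X + X') Y Z x = koszul I X Y Z x + koszul I X' Y Z x := by
  unfold koszul
  rw [mvfderiv_inner_add hX hX' hY, mvfderiv_inner_add hX hX' hZ,
    VectorField.mlieBracket_add_left hX hX', VectorField.mlieBracket_add_left hX hX']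
  simp only [inner_add_left, inner_add_right, Pi.add_apply, map_add]
  ring

theorem koszul_smul_left {f : M → ℝ} {X Y Z : Π x : M, TangentSpace I x} {x : M}
    (hf : MDiffAt f x) (hX : MDiffAt (T% X) x)
    (hY : MDiffAt (T% Y) x) (hZ : MDiffAt (T% Z) x) :
    koszul I (f • X) Y Z x = f x * koszul I X Y Z x := by
  unfold koszul
  rw [mvfderiv_inner_smul hf hX hY, mvfderiv_inner_smul hf hX hZ,
    VectorField.mlieBracket_smul_left hf hX, VectorField.mlieBracket_smul_left hf hX]
  simp only [inner_add_left, Pi.smul_apply', map_smul, smul_eq_mul, real_inner_smul_left,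
    real_inner_smul_right]
  ring

theorem koszul_add_middle {X Y Y' Z : Π x : M, TangentSpace I x} {x : M}
    (hX : MDiffAt (T% X) x) (hY : MDiffAt (T% Y) x) (hY' : MDiffAt (T% Y') x)
    (hZ : MDiffAt (T% Z) x) :
    koszul I X (Y + Y') Z x = koszul I X Y Z x + koszul I X Y' Z x := by
  have h1 := koszul_sub_swap_left X (Y + Y') Z x
  rw [VectorField.mlieBracket_add_right hY hY', inner_add_left,
    koszul_add_left hY hY' hX hZ] at h1
  linear_combination h1 - koszul_sub_swap_left X Y Z x - koszul_sub_swap_left X Y' Z x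

theorem koszul_smul_middle {f : M → ℝ} {X Y Z : Π x : M, TangentSpace I x} {x : M}
    (hf : MDiffAt f x) (hX : MDiffAt (T% X) x)
    (hY : MDiffAt (T% Y) x) (hZ : MDiffAt (T% Z) x) :
    koszul I X (f • Y) Z x =
      f x * koszul I X Y Z x + 2 * (mvfderiv I f x (X x) * inner ℝ (Y x) (Z x)) := by
  have h1 := koszul_sub_swap_left X (f • Y) Z x
  rw [VectorField.mlieBracket_smul_right hf hY, inner_add_left, real_inner_smul_left,
    real_inner_smul_left, koszul_smul_left hf hY hX hZ] at h1
  linear_combination h1 - f x * koszul_sub_swap_left X Y Z x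

theorem koszul_add_right {X Y Z Z' : Π x : M, TangentSpace I x} {x : M}
    (hX : MDiffAt (T% X) x) (hY : MDiffAt (T% Y) x) (hZ : MDiffAt (T% Z) x)
    (hZ' : MDiffAt (T% Z') x) :
    koszul I X Y (Z + Z') x = koszul I X Y Z x + koszul I X Y Z' x := by
  have h1 := koszul_add_swap_right X (Z + Z') Y x
  rw [mvfderiv_inner_add hZ hZ' hY, koszul_add_middle hX hZ hZ' hY] at h1
  linear_combination h1 - koszul_add_swap_right X Z Y x - koszul_add_swap_right X Z' Y x

theorem koszul_smul_right {f : M → ℝ} {X Y Z : Π x : M, TangentSpace I x} {x : M}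
    (hf : MDiffAt f x) (hX : MDiffAt (T% X) x)
    (hY : MDiffAt (T% Y) x) (hZ : MDiffAt (T% Z) x) :
    koszul I X Y (f • Z) x = f x * koszul I X Y Z x := by
  have h1 := koszul_add_swap_right X (f • Z) Y x
  rw [mvfderiv_inner_smul hf hZ hY, koszul_smul_middle hf hX hZ hY] at h1
  linear_combination h1 - f x * koszul_add_swap_right X Z Y x

variable (I) in
/-- For a vector field `Y` differentiable at `x`, the bilinear form
`(X, Z) ↦ 2 g(∇_X Y, Z)` on the tangent space at `x`. -/
def koszulForm (Y : Π x : M, TangentSpace I x) (x : M) (hY : MDiffAt (T% Y) x) :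
    TangentSpace I x →L[ℝ] TangentSpace I x →L[ℝ] ℝ :=
  TensorialAt.mkHom₂ (I := I) (F := E) (F' := E) (fun X Z ↦ koszul I X Y Z x) x
    (fun _ hZ ↦ ⟨fun hf hX ↦ koszul_smul_left hf hX hY hZ,
      fun hX hX' ↦ koszul_add_left hX hX' hY hZ⟩)
    (fun _ hX ↦ ⟨fun hf hZ ↦ koszul_smul_right hf hX hY hZ,
      fun hZ hZ' ↦ koszul_add_right hX hY hZ hZ'⟩)

theorem koszulForm_apply {X Y Z : Π x : M, TangentSpace I x} {x : M}
    (hX : MDiffAt (T% X) x) (hY : MDiffAt (T% Y) x) (hZ : MDiffAt (T% Z) x) :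
    koszulForm I Y x hY (X x) (Z x) = koszul I X Y Z x :=
  TensorialAt.mkHom₂_apply (I := I) (F := E) (F' := E) _ _ hX hZ

instance finiteDimensional_tangentSpace (x : M) : FiniteDimensional ℝ (TangentSpace I x) :=
  inferInstanceAs (FiniteDimensional ℝ E)

open Classical in
variable (I) in
/-- The covariant derivative `v ↦ ∇_v Y` at `x` determined by the Koszul formula (zero, by
convention, if `Y` is not differentiable at `x`). -/
def leviCivitaFun (Y : Π x : M, TangentSpace I x) (x : M) :
    TangentSpace I x →L[ℝ] TangentSpace I x :=
  if hY : MDiffAt (T% Y) x then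
    (1 / 2 : ℝ) • ∑ i, ((koszulForm I Y x hY).flip
      (stdOrthonormalBasis ℝ (TangentSpace I x) i)).smulRight
        (stdOrthonormalBasis ℝ (TangentSpace I x) i)
  else 0

theorem inner_leviCivitaFun {Y : Π x : M, TangentSpace I x} {x : M} (hY : MDiffAt (T% Y) x)
    (v w : TangentSpace I x) :
    inner ℝ (leviCivitaFun I Y x v) w = 1 / 2 * koszulForm I Y x hY v w := by
  set b := stdOrthonormalBasis ℝ (TangentSpace I x) with hb
  have hw : koszulForm I Y x hY v w =
      ∑ i, inner ℝ (b i) w * koszulForm I Y x hY v (b i) := by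
    conv_lhs => rw [← b.sum_repr' w]
    simp [map_sum]
  rw [hw]
  simp only [leviCivitaFun, hY, dif_pos, ← hb]
  simp only [smul_apply, sum_apply,
    ContinuousLinearMap.smulRight_apply, ContinuousLinearMap.flip_apply, real_inner_smul_left,
    sum_inner]
  congr 1
  exact Finset.sum_congr rfl fun i _ ↦ mul_comm _ _

/-- The Koszul formula. -/
theorem inner_leviCivitaFun_eq_koszul {X Y Z : Π x : M, TangentSpace I x} {x : M}
    (hX : MDiffAt (T% X) x) (hY : MDiffAt (T% Y) x) (hZ : MDiffAt (T% Z) x) :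
    inner ℝ (leviCivitaFun I Y x (X x)) (Z x) = 1 / 2 * koszul I X Y Z x := by
  rw [inner_leviCivitaFun hY, koszulForm_apply hX hY hZ]

theorem ext_inner_fields {x : M} {A B : TangentSpace I x →L[ℝ] TangentSpace I x}
    (h : ∀ X Z : Π x : M, TangentSpace I x, MDiffAt (T% X) x → MDiffAt (T% Z) x →
      inner ℝ (A (X x)) (Z x) = inner ℝ (B (X x)) (Z x)) : A = B := by
  ext v
  refine ext_inner_right ℝ fun w ↦ ?_
  have := h (FiberBundle.extend E v) (FiberBundle.extend E w)
    (FiberBundle.mdifferentiableAt_extend ..) (FiberBundle.mdifferentiableAt_extend ..)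
  simpa using this

variable (I M) in
/-- The Levi-Civita connection of a Riemannian manifold. -/
def leviCivita : CovariantDerivative I E (TangentSpace I : M → Type _) where
  toFun := leviCivitaFun I
  isCovariantDerivativeOnUniv :=
    { add := fun {Y Y' x} hY hY' _ ↦ ext_inner_fields fun X Z hX hZ ↦ by
        have hs : MDiffAt (T% (Y + Y')) x := mdifferentiableAt_add_section hY hY'
        rw [add_apply, inner_add_left,
          inner_leviCivitaFun_eq_koszul hX hs hZ, inner_leviCivitaFun_eq_koszul hX hY hZ,
          inner_leviCivitaFun_eq_koszul hX hY' hZ, koszul_add_middle hX hY hY' hZ]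
        ring
      leibniz := fun {Y f x} hY hf _ ↦ ext_inner_fields fun X Z hX hZ ↦ by
        have hs : MDiffAt (T% (f • Y)) x := hf.smul_section hY
        rw [add_apply, inner_add_left, smul_apply,
          ContinuousLinearMap.smulRight_apply, real_inner_smul_left, real_inner_smul_left,
          inner_leviCivitaFun_eq_koszul hX hs hZ, inner_leviCivitaFun_eq_koszul hX hY hZ,
          koszul_smul_middle hf hX hY hZ]
        ring }

theorem leviCivita_torsion : (leviCivita I M).torsion = 0 := by
  rw [CovariantDerivative.torsion_eq_zero_iff]
  intro X Y x hX hY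
  refine ext_inner_right ℝ fun w ↦ ?_
  have hW : MDiffAt (T% (FiberBundle.extend E w : Π x : M, TangentSpace I x)) x :=
    FiberBundle.mdifferentiableAt_extend ..
  have h1 := inner_leviCivitaFun_eq_koszul hX hY hW
  have h2 := inner_leviCivitaFun_eq_koszul hY hX hW
  have h3 := koszul_sub_swap_left X Y (FiberBundle.extend E w) x
  rw [FiberBundle.extend_apply_self] at h1 h2 h3
  rw [inner_sub_left]
  change inner ℝ (leviCivitaFun I Y x (X x)) w - inner ℝ (leviCivitaFun I X x (Y x)) w = _
  linear_combination h1 - h2 + h3 / 2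

theorem leviCivita_metric {X Y Z : Π x : M, TangentSpace I x} {x : M}
    (hX : MDiffAt (T% X) x) (hY : MDiffAt (T% Y) x) (hZ : MDiffAt (T% Z) x) :
    mvfderiv I (fun y ↦ (inner ℝ (Y y) (Z y) : ℝ)) x (X x) =
      inner ℝ (leviCivita I M Y x (X x)) (Z x) + inner ℝ (Y x) (leviCivita I M Z x (X x)) := by
  have h1 := inner_leviCivitaFun_eq_koszul hX hY hZ
  have h2 := inner_leviCivitaFun_eq_koszul hX hZ hY
  have h3 := koszul_add_swap_right X Y Z x
  rw [real_inner_comm] at h2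
  change _ = inner ℝ (leviCivitaFun I Y x (X x)) (Z x) + inner ℝ (Y x) (leviCivitaFun I Z x (X x))
  linear_combination - h1 - h2 - h3 / 2

variable (I) in
/-- The curvature operator `R(X,Y)Z = ∇_X ∇_Y Z - ∇_Y ∇_X Z - ∇_[X,Y] Z` on vector fields. -/
def curvatureField (X Y Z : Π x : M, TangentSpace I x) (x : M) : TangentSpace I x :=
  leviCivita I M (fun y ↦ leviCivita I M Z y (Y y)) x (X x)
    - leviCivita I M (fun y ↦ leviCivita I M Z y (X y)) x (Y x)
    - leviCivita I M Z x (VectorField.mlieBracket I X Y x)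

variable (I) in
/-- The curvature tensor `R(u,v)w` at `x`, for tangent vectors `u v w` at `x`. Since `R(X,Y)Z` is
tensorial, it is computed with arbitrary extensions of `u v w` that are smooth near `x`;
`FiberBundle.extend` takes those with constant components in the preferred chart at `x`. -/
def curvature (x : M) (u v w : TangentSpace I x) : TangentSpace I x :=
  curvatureField I (FiberBundle.extend E u) (FiberBundle.extend E v) (FiberBundle.extend E w) x

variable (I) in
/-- The Ricci tensor `ρ(u,v)` at `x`, the trace of `w ↦ R(w,u)v`. -/
def ricci (x : M) (u v : TangentSpace I x) : ℝ :=
  ∑ a, inner ℝ (curvature I x (stdOrthonormalBasis ℝ (TangentSpace I x) a) u v)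
    (stdOrthonormalBasis ℝ (TangentSpace I x) a)

variable (I M) in
/-- `M` is an Einstein manifold: `ρ = c g` for some real constant `c`. -/
def IsEinstein : Prop :=
  ∃ c : ℝ, ∀ (x : M) (u v : TangentSpace I x), ricci I x u v = c * inner ℝ u v

variable (I) in
/-- The components `R_abcd = g(R(e_a,e_b)e_c,e_d)` of the curvature tensor with respect to an
orthonormal basis `e` of the tangent space at `x`. -/
def curvatureComponents {ι : Type*} [Fintype ι] {x : M}
    (e : OrthonormalBasis ι ℝ (TangentSpace I x)) (a b c d : ι) : ℝ :=
  inner ℝ (curvature I x (e a) (e b) (e c)) (e d)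

end

end LeviCivita

noncomputable section Contractions

variable {ι : Type*} [Fintype ι] (R : ι → ι → ι → ι → ℝ)

/-- The Ricci components `ρ_ij = R_aija`. -/
def ricciComponents (i j : ι) : ℝ := ∑ a, R a i j a

/-- The scalar curvature `τ = ρ_ii`. -/
def scalarCurvature : ℝ := ∑ i, ricciComponents R i i

/-- `|R|^2 = R_abcd R_abcd`. -/
def curvatureNormSq : ℝ := ∑ a, ∑ b, ∑ c, ∑ d, R a b c d * R a b c d

/-- `R_iabc R_jabc`. -/
def curvatureSq (i j : ι) : ℝ := ∑ a, ∑ b, ∑ c, R i a b c * R j a b c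

/-- `Ř_ij = R_iuvj R_abcu R_abcv`. -/
def checkR (i j : ι) : ℝ :=
  ∑ u, ∑ v, ∑ a, ∑ b, ∑ c, R i u v j * R a b c u * R a b c v

/-- `R̂_ij = R_ibac R_jbuv R_acuv`. -/
def hatR (i j : ι) : ℝ :=
  ∑ a, ∑ b, ∑ c, ∑ u, ∑ v, R i b a c * R j b u v * R a c u v

/-- `R̊_ij = R_iabc R_jubv R_aucv`. -/
def ringR (i j : ι) : ℝ :=
  ∑ a, ∑ b, ∑ c, ∑ u, ∑ v, R i a b c * R j u b v * R a u c v

end Contractions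

end RiemGeom

open scoped Topology

namespace RiemGeom

/-! The identity is algebraic and special to dimension five. Skew-symmetrizing over six indices
gives zero there. Contracting this with `R ⊗ R` for an Einstein tensor (`ρ = c g`) leaves a
quadratic identity: `quadCurv R c` equals `|R|^2/4 + 5c^2/4` times `g_jk g_il - g_ik g_jl`
(`quadCurv_eq`). The code proves this in coordinates: both sides are skew in each index pair and
compatible with relabelling the basis, so three components suffice (`quadCurv_components`).

Contracting the quadratic identity with `R_njkl` makes it cubic. The left side becomes a combination
of `hatR`, `checkR`, `curvatureSq` and the auxiliary contraction `cyclicR` (`sum_quadCurv_mul`), and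
the right side becomes `2c(|R|^2/4 + 5c^2/4) g_in`. The first Bianchi identity exchanges `cyclicR`
for `ringR` (`ringR_eq`), and `τ = 5c` gives the stated coefficients (`cubic_einstein_identity`).

It remains to see that the curvature of the Levi-Civita connection has the algebraic symmetries
(`isAlgCurvature_curvatureComponents`) and that its Ricci trace does not depend on the orthonormal
basis (`ricciComponents_curvatureComponents`). The analytic input is that `∇_X Y` is differentiable
for smooth `X`, `Y`. It comes from the Koszul formula, a Gram matrix argument and the calculus of
Lie brackets. -/

/-- The algebraic symmetries of a curvature tensor. -/
structure IsAlgCurvature {ι : Type*} (R : ι → ι → ι → ι → ℝ) : Prop where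
  antisymm_left : ∀ a b c d, R a b c d = -R b a c d
  antisymm_right : ∀ a b c d, R a b c d = -R a b d c
  bianchi : ∀ a b c d, R a b c d + R b c a d + R c a b d = 0

/-! ### Symmetries of algebraic curvature tensors. -/

namespace IsAlgCurvature

variable {ι : Type*} {R : ι → ι → ι → ι → ℝ}

/-- A signed combination of the Bianchi identities for the four cyclic shifts of `a b c d`: modulo
the two antisymmetries all other terms cancel. -/
theorem pair_symm (hR : IsAlgCurvature R) (a b c d : ι) : R a b c d = R c d a b := by
  linarith [hR.bianchi a b c d, hR.bianchi b c d a, hR.bianchi c d a b, hR.bianchi d a b c,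
    hR.antisymm_left c a b d, hR.antisymm_left d b c a, hR.antisymm_left a c d b,
    hR.antisymm_left b d a c, hR.antisymm_right a b c d, hR.antisymm_right b c d a,
    hR.antisymm_right c d a b, hR.antisymm_right d a b c, hR.antisymm_right a c b d,
    hR.antisymm_right b d c a, hR.antisymm_right c a d b, hR.antisymm_right d b a c,
    hR.antisymm_left c d a b, hR.antisymm_left b c a d, hR.antisymm_left d a c b]

theorem left_self (hR : IsAlgCurvature R) (a c d : ι) : R a a c d = 0 := by
  linarith [hR.antisymm_left a a c d]

theorem right_self (hR : IsAlgCurvature R) (a b c : ι) : R a b c c = 0 := by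
  linarith [hR.antisymm_right a b c c]

theorem comp (hR : IsAlgCurvature R) {κ : Type*} (f : κ → ι) :
    IsAlgCurvature fun a b c d ↦ R (f a) (f b) (f c) (f d) :=
  ⟨fun _ _ _ _ ↦ hR.antisymm_left .., fun _ _ _ _ ↦ hR.antisymm_right ..,
    fun _ _ _ _ ↦ hR.bianchi ..⟩

end IsAlgCurvature

/-! ### The quadratic identity in dimension five. -/

section Quadratic

variable {ι : Type*} [Fintype ι] [DecidableEq ι]

/-- The double contraction of the Kulkarni-Nomizu square of an Einstein curvature tensor with
Einstein constant `c`, up to the multiples of the squared metric. -/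
noncomputable def quadCurv (R : ι → ι → ι → ι → ℝ) (c : ℝ) (i j k l : ι) : ℝ :=
  ∑ a, ∑ b, R i j a b * R a b k l
    - 2 * ∑ a, ∑ b, (R i a k b * R j b l a - R j a k b * R i b l a) + 3 * c * R i j k l
    + (if j = k then curvatureSq R i l else 0) + (if i = l then curvatureSq R j k else 0)
    - (if i = k then curvatureSq R j l else 0) - (if j = l then curvatureSq R i k else 0)

end Quadratic

section Components

variable {R : Fin 5 → Fin 5 → Fin 5 → Fin 5 → ℝ} {c : ℝ}

/-- Up to relabelling the basis and the skew symmetries, a pair of index pairs can share no index,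
one index or both. These are the three representatives. -/
theorem quadCurv_components (hR : IsAlgCurvature R)
    (hc : ∀ i j, ricciComponents R i j = if i = j then c else 0) :
    quadCurv R c 0 1 2 3 = 0 ∧ quadCurv R c 0 1 0 2 = 0 ∧
      quadCurv R c 0 1 0 1 = -(curvatureNormSq R / 4 + 5 / 4 * c ^ 2) := by
  have h00 := hc 0 0
  have h01 := hc 0 1
  have h02 := hc 0 2
  have h03 := hc 0 3
  have h04 := hc 0 4
  have h11 := hc 1 1
  have h12 := hc 1 2
  have h13 := hc 1 3
  have h14 := hc 1 4
  have h22 := hc 2 2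
  have h23 := hc 2 3
  have h24 := hc 2 4
  have h33 := hc 3 3
  have h34 := hc 3 4
  have h44 := hc 4 4
  simp only [ricciComponents, Fin.sum_univ_five, Fin.reduceEq, if_true, if_false]
    at h00 h01 h02 h03 h04 h11 h12 h13 h14 h22 h23 h24 h33 h34 h44
  simp only [quadCurv, curvatureSq, curvatureNormSq, Fin.sum_univ_five, Fin.reduceEq,
    if_true, if_false]
  -- Normal form: both index pairs increasing, and the lexicographically smaller pair first.
  simp only [hR.left_self, hR.right_self,
    hR.antisymm_left 1 0, hR.antisymm_left 2 0, hR.antisymm_left 3 0, hR.antisymm_left 4 0,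
    hR.antisymm_left 2 1, hR.antisymm_left 3 1, hR.antisymm_left 4 1, hR.antisymm_left 3 2,
    hR.antisymm_left 4 2, hR.antisymm_left 4 3, hR.antisymm_right _ _ 1 0,
    hR.antisymm_right _ _ 2 0, hR.antisymm_right _ _ 3 0, hR.antisymm_right _ _ 4 0,
    hR.antisymm_right _ _ 2 1, hR.antisymm_right _ _ 3 1, hR.antisymm_right _ _ 4 1,
    hR.antisymm_right _ _ 3 2, hR.antisymm_right _ _ 4 2, hR.antisymm_right _ _ 4 3,
    hR.pair_symm 0 2 0 1, hR.pair_symm 0 3 0 1, hR.pair_symm 0 3 0 2, hR.pair_symm 0 4 0 1,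
    hR.pair_symm 0 4 0 2, hR.pair_symm 0 4 0 3, hR.pair_symm 1 2 0 1, hR.pair_symm 1 2 0 2,
    hR.pair_symm 1 2 0 3, hR.pair_symm 1 2 0 4, hR.pair_symm 1 3 0 1, hR.pair_symm 1 3 0 2,
    hR.pair_symm 1 3 0 3, hR.pair_symm 1 3 0 4, hR.pair_symm 1 3 1 2, hR.pair_symm 1 4 0 1,
    hR.pair_symm 1 4 0 2, hR.pair_symm 1 4 0 3, hR.pair_symm 1 4 0 4, hR.pair_symm 1 4 1 2,
    hR.pair_symm 1 4 1 3, hR.pair_symm 2 3 0 1, hR.pair_symm 2 3 0 2, hR.pair_symm 2 3 0 3,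
    hR.pair_symm 2 3 0 4, hR.pair_symm 2 3 1 2, hR.pair_symm 2 3 1 3, hR.pair_symm 2 3 1 4,
    hR.pair_symm 2 4 0 1, hR.pair_symm 2 4 0 2, hR.pair_symm 2 4 0 3, hR.pair_symm 2 4 0 4,
    hR.pair_symm 2 4 1 2, hR.pair_symm 2 4 1 3, hR.pair_symm 2 4 1 4, hR.pair_symm 2 4 2 3,
    hR.pair_symm 3 4 0 1, hR.pair_symm 3 4 0 2, hR.pair_symm 3 4 0 3, hR.pair_symm 3 4 0 4,
    hR.pair_symm 3 4 1 2, hR.pair_symm 3 4 1 3, hR.pair_symm 3 4 1 4, hR.pair_symm 3 4 2 3,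
    hR.pair_symm 3 4 2 4] at h00 h01 h02 h03 h04 h11 h12 h13 h14 h22 h23 h24 h33 h34 h44 ⊢
  -- The five diagonal Ricci equations, solved as a linear system for `c` and four of the ten
  -- components `R a b a b`.
  have hcc : c = -(R 0 1 0 1 + R 0 2 0 2 + R 0 3 0 3 + R 0 4 0 4) := by linarith
  have e23 : R 2 3 2 3 = (R 0 1 0 1 + R 0 2 0 2 + R 0 3 0 3 + 3 * R 0 4 0 4) / 2
      - R 1 2 1 2 - R 1 3 1 3 := by linarith
  have e14 : R 1 4 1 4 = R 0 2 0 2 + R 0 3 0 3 + R 0 4 0 4 - R 1 2 1 2 - R 1 3 1 3 := by linarith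
  have e24 : R 2 4 2 4 = R 0 1 0 1 + R 0 3 0 3 + R 0 4 0 4 - R 1 2 1 2 - R 2 3 2 3 := by linarith
  have e34 : R 3 4 3 4 = R 0 1 0 1 + R 0 2 0 2 + R 0 4 0 4 - R 1 3 1 3 - R 2 3 2 3 := by linarith
  -- Each of the ten off-diagonal Ricci equations eliminates one component with exactly three
  -- distinct indices.
  have o01 : R 0 4 1 4 = -R 0 2 1 2 - R 0 3 1 3 := by linarith
  have o02 : R 0 4 2 4 = R 0 1 1 2 - R 0 3 2 3 := by linarith
  have o03 : R 0 4 3 4 = R 0 1 1 3 + R 0 2 2 3 := by linarith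
  have o04 : R 0 3 3 4 = -R 0 1 1 4 - R 0 2 2 4 := by linarith
  have o12 : R 1 4 2 4 = -R 0 1 0 2 - R 1 3 2 3 := by linarith
  have o13 : R 1 4 3 4 = -R 0 1 0 3 + R 1 2 2 3 := by linarith
  have o14 : R 1 3 3 4 = R 0 1 0 4 - R 1 2 2 4 := by linarith
  have o23 : R 2 4 3 4 = -R 0 2 0 3 - R 1 2 1 3 := by linarith
  have o24 : R 2 3 3 4 = R 0 2 0 4 + R 1 2 1 4 := by linarith
  have o34 : R 2 3 2 4 = -R 0 3 0 4 - R 1 3 1 4 := by linarith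
  -- One Bianchi identity for each four-element subset of the indices. Of the 55 components in
  -- normal form 36 remain, now independent, so the claims are polynomial identities in them.
  have b0123 : R 0 2 1 3 = R 0 1 2 3 + R 0 3 1 2 := by
    linarith [hR.bianchi 0 1 2 3, hR.pair_symm 1 2 0 3, hR.antisymm_left 2 0 1 3]
  have b0124 : R 0 2 1 4 = R 0 1 2 4 + R 0 4 1 2 := by
    linarith [hR.bianchi 0 1 2 4, hR.pair_symm 1 2 0 4, hR.antisymm_left 2 0 1 4]
  have b0134 : R 0 3 1 4 = R 0 1 3 4 + R 0 4 1 3 := by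
    linarith [hR.bianchi 0 1 3 4, hR.pair_symm 1 3 0 4, hR.antisymm_left 3 0 1 4]
  have b0234 : R 0 3 2 4 = R 0 2 3 4 + R 0 4 2 3 := by
    linarith [hR.bianchi 0 2 3 4, hR.pair_symm 2 3 0 4, hR.antisymm_left 3 0 2 4]
  have b1234 : R 1 3 2 4 = R 1 2 3 4 + R 1 4 2 3 := by
    linarith [hR.bianchi 1 2 3 4, hR.pair_symm 2 3 1 4, hR.antisymm_left 3 1 2 4]
  refine ⟨?_, ?_, ?_⟩ <;>
    · simp only [e14, e24, e34, e23, o01, o02, o03, o04, o12, o13, o14, o23, o24, o34,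
        b0123, b0124, b0134, b0234, b1234]
      rw [hcc]
      ring

end Components

section QuadraticIdentity

theorem quadCurv_swap_left {ι : Type*} [Fintype ι] [DecidableEq ι] {R : ι → ι → ι → ι → ℝ}
    (hR : IsAlgCurvature R) (c : ℝ) (i j k l : ι) :
    quadCurv R c j i k l = -quadCurv R c i j k l := by
  have h1 : ∑ a, ∑ b, R j i a b * R a b k l = -∑ a, ∑ b, R i j a b * R a b k l := by
    simp only [← Finset.sum_neg_distrib, hR.antisymm_left j i, neg_mul]
  have h2 : ∑ a, ∑ b, (R j a k b * R i b l a - R i a k b * R j b l a) =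
      -∑ a, ∑ b, (R i a k b * R j b l a - R j a k b * R i b l a) := by
    simp only [← Finset.sum_neg_distrib, neg_sub]
  simp only [quadCurv]
  rw [h1, h2, hR.antisymm_left j i k l]
  ring

theorem quadCurv_swap_right {ι : Type*} [Fintype ι] [DecidableEq ι] {R : ι → ι → ι → ι → ℝ}
    (hR : IsAlgCurvature R) (c : ℝ) (i j k l : ι) :
    quadCurv R c i j l k = -quadCurv R c i j k l := by
  have h1 : ∑ a, ∑ b, R i j a b * R a b l k = -∑ a, ∑ b, R i j a b * R a b k l := by
    simp only [← Finset.sum_neg_distrib, hR.antisymm_right _ _ l k, mul_neg]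
  have h2 : ∑ a, ∑ b, (R i a l b * R j b k a - R j a l b * R i b k a) =
      -∑ a, ∑ b, (R i a k b * R j b l a - R j a k b * R i b l a) := by
    rw [Finset.sum_comm]
    simp only [← Finset.sum_neg_distrib]
    refine Finset.sum_congr rfl fun a _ ↦ Finset.sum_congr rfl fun b _ ↦ ?_
    ring
  simp only [quadCurv]
  rw [h1, h2, hR.antisymm_right i j l k]
  ring

/-- Permuting an orthonormal basis again gives an Einstein curvature tensor; this transports the
three computed components to arbitrary distinct indices. -/
theorem quadCurv_comp {ι κ : Type*} [Fintype ι] [DecidableEq ι] [Fintype κ] [DecidableEq κ]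
    (R : ι → ι → ι → ι → ℝ) (c : ℝ) (σ : κ ≃ ι) (i j k l : κ) :
    quadCurv (fun a b c d ↦ R (σ a) (σ b) (σ c) (σ d)) c i j k l =
      quadCurv R c (σ i) (σ j) (σ k) (σ l) := by
  simp only [quadCurv, curvatureSq, ← Equiv.sum_comp σ, σ.injective.eq_iff]

theorem ricciComponents_comp {ι κ : Type*} [Fintype ι] [Fintype κ]
    (R : ι → ι → ι → ι → ℝ) (σ : κ ≃ ι) (i j : κ) :
    ricciComponents (fun a b c d ↦ R (σ a) (σ b) (σ c) (σ d)) i j =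
      ricciComponents R (σ i) (σ j) := by
  simp only [ricciComponents, ← Equiv.sum_comp σ]

theorem curvatureNormSq_comp {ι κ : Type*} [Fintype ι] [Fintype κ]
    (R : ι → ι → ι → ι → ℝ) (σ : κ ≃ ι) :
    curvatureNormSq (fun a b c d ↦ R (σ a) (σ b) (σ c) (σ d)) = curvatureNormSq R := by
  simp only [curvatureNormSq, ← Equiv.sum_comp σ]

theorem exists_perm_fin_five {i j k l : Fin 5} (hij : i ≠ j) (hik : i ≠ k) (hil : i ≠ l)
    (hjk : j ≠ k) (hjl : j ≠ l) (hkl : k ≠ l) :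
    ∃ σ : Fin 5 ≃ Fin 5, σ 0 = i ∧ σ 1 = j ∧ σ 2 = k ∧ σ 3 = l := by
  obtain ⟨m, hm⟩ : ∃ m, m ∉ ({i, j, k, l} : Finset (Fin 5)) := by
    by_contra! h
    have := (Finset.card_le_card (fun m _ ↦ h m : Finset.univ ⊆ _)).trans Finset.card_le_four
    simp at this
  simp only [Finset.mem_insert, Finset.mem_singleton, not_or] at hm
  have hf : Function.Injective ![i, j, k, l, m] := by
    intro a b hab
    fin_cases a <;> fin_cases b <;> simp_all [eq_comm]
  exact ⟨Equiv.ofBijective _ (Finite.injective_iff_bijective.1 hf), rfl, rfl, rfl, rfl⟩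

variable {R : Fin 5 → Fin 5 → Fin 5 → Fin 5 → ℝ} {c : ℝ}

theorem quadCurv_of_distinct (hR : IsAlgCurvature R)
    (hc : ∀ i j, ricciComponents R i j = if i = j then c else 0) {i j k l : Fin 5}
    (hij : i ≠ j) (hik : i ≠ k) (hil : i ≠ l) (hjk : j ≠ k) (hjl : j ≠ l) (hkl : k ≠ l) :
    quadCurv R c i j k l = 0 ∧ quadCurv R c i j i k = 0 ∧
      quadCurv R c i j i j = -(curvatureNormSq R / 4 + 5 / 4 * c ^ 2) := by
  obtain ⟨σ, rfl, rfl, rfl, rfl⟩ := exists_perm_fin_five hij hik hil hjk hjl hkl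
  have := quadCurv_components (hR.comp σ) (c := c) fun i j ↦ by
    rw [ricciComponents_comp, hc]
    simp only [σ.injective.eq_iff]
  simpa only [quadCurv_comp, curvatureNormSq_comp] using this

theorem exists_fin_five_ne (i j k : Fin 5) : ∃ l, i ≠ l ∧ j ≠ l ∧ k ≠ l := by
  revert i j k; decide

/-- In dimension five the antisymmetrization over six indices vanishes; contracted with `R ⊗ R` for
an Einstein curvature tensor `R`, it says that `quadCurv R c` is a multiple of the squared metric. -/
theorem quadCurv_eq (hR : IsAlgCurvature R)
    (hc : ∀ i j, ricciComponents R i j = if i = j then c else 0) (i j k l : Fin 5) :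
    quadCurv R c i j k l = (curvatureNormSq R / 4 + 5 / 4 * c ^ 2) *
      ((if j = k then 1 else 0) * (if i = l then 1 else 0)
        - (if i = k then 1 else 0) * (if j = l then 1 else 0)) := by
  -- The extra index `l` only completes the triple to four distinct indices, as
  -- `quadCurv_of_distinct` requires.
  have h3 : ∀ {i j k}, i ≠ j → i ≠ k → j ≠ k → quadCurv R c i j i k = 0 := fun {i j k} h h' h'' ↦ by
    obtain ⟨l, h1, h2, h3⟩ := exists_fin_five_ne i j k
    exact (quadCurv_of_distinct hR hc h h' h1 h'' h2 h3).2.1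
  have h2 : ∀ {i j}, i ≠ j →
      quadCurv R c i j i j = -(curvatureNormSq R / 4 + 5 / 4 * c ^ 2) := fun {i j} h ↦ by
    obtain ⟨k, h1, h2, -⟩ := exists_fin_five_ne i j j
    obtain ⟨l, h3, h4, h5⟩ := exists_fin_five_ne i j k
    exact (quadCurv_of_distinct hR hc h h1 h3 h2 h4 h5).2.2
  rcases eq_or_ne i j with rfl | hij
  · have : quadCurv R c i i k l = 0 := by linarith [quadCurv_swap_left hR c i i k l]
    rw [this]
    ring
  rcases eq_or_ne k l with rfl | hkl
  · have : quadCurv R c i j k k = 0 := by linarith [quadCurv_swap_right hR c i j k k]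
    rw [this]
    ring
  by_cases hik : i = k
  · subst hik
    by_cases hjl : j = l
    · subst hjl
      simp [h2 hij, hij.symm]
    · simp [h3 hij hkl hjl, hij.symm, hjl]
  by_cases hjk : j = k
  · subst hjk
    rw [quadCurv_swap_left hR]
    by_cases hil : i = l
    · subst hil
      simp [h2 hij.symm, hij]
    · simp [h3 hij.symm hkl hil, hij, hil]
  by_cases hil : i = l
  · subst hil
    rw [quadCurv_swap_right hR, h3 hij hik hjk]
    simp [hik, hjk]
  by_cases hjl : j = l
  · subst hjl
    rw [quadCurv_swap_right hR, quadCurv_swap_left hR, h3 hij.symm hjk hik]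
    simp [hik, hjk]
  rw [(quadCurv_of_distinct hR hc hij hik hil hjk hjl hkl).1]
  simp [hik, hjk]

end QuadraticIdentity

/-! ### Cubic contractions of the curvature tensor. -/

section Cubic

variable {ι : Type*} [Fintype ι] {R : ι → ι → ι → ι → ℝ}

/-- The contraction `R_iakb R_jbla R_njkl`. -/
noncomputable def cyclicR (R : ι → ι → ι → ι → ℝ) (i n : ι) : ℝ :=
  ∑ j, ∑ k, ∑ l, ∑ a, ∑ b, R i a k b * R j b l a * R n j k l

theorem curvatureSq_comm (i j : ι) : curvatureSq R i j = curvatureSq R j i := by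
  simp only [curvatureSq, mul_comm]

/-- Bianchi turns the contraction of `R` with a bivector into twice a skew contraction. -/
theorem IsAlgCurvature.sum_skew (hR : IsAlgCurvature R) (i k : ι) (f : ι → ι → ℝ)
    (hf : ∀ a b, f a b = -f b a) :
    ∑ a, ∑ b, R i a k b * f a b = (∑ a, ∑ b, R i k a b * f a b) / 2 := by
  have h : ∑ a, ∑ b, R i a k b * f a b = ∑ a, ∑ b, -(R i b k a * f a b) := by
    rw [Finset.sum_comm]
    refine Finset.sum_congr rfl fun a _ ↦ Finset.sum_congr rfl fun b _ ↦ ?_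
    rw [hf]
    ring
  have h' : ∑ a, ∑ b, R i k a b * f a b =
      ∑ a, ∑ b, R i a k b * f a b + ∑ a, ∑ b, -(R i b k a * f a b) := by
    simp only [← Finset.sum_add_distrib]
    refine Finset.sum_congr rfl fun a _ ↦ Finset.sum_congr rfl fun b _ ↦ ?_
    have := hR.bianchi i k a b
    rw [hR.antisymm_left a i, hR.pair_symm k a] at this
    linear_combination this * f a b
  linarith

theorem sum_reorder (f : ι → ι → ι → ι → ι → ℝ) :
    ∑ a, ∑ b, ∑ c, ∑ u, ∑ v, f a b c u v = ∑ u, ∑ b, ∑ v, ∑ a, ∑ c, f a b c u v := by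
  simp only [← Fintype.sum_prod_type']
  exact Fintype.sum_equiv ⟨fun p ↦ (p.2.2.2.1, p.2.1, p.2.2.2.2, p.1, p.2.2.1),
    fun p ↦ (p.2.2.2.1, p.2.1, p.2.2.2.2, p.1, p.2.2.1), fun _ ↦ rfl, fun _ ↦ rfl⟩ _ _ fun _ ↦ rfl

/-- Bianchi splits the last factor, after renaming, as `R_ajbl = R_jbla + R_jlab`. The first term
gives `cyclicR`. The second is skew in `a, b` and in `j, l`, so `IsAlgCurvature.sum_skew` applies
twice, each time with a factor `1/2`. -/
theorem ringR_eq (hR : IsAlgCurvature R) (i n : ι) :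
    ringR R i n = cyclicR R i n + hatR R i n / 4 := by
  have h1 : ringR R i n = cyclicR R i n +
      ∑ j, ∑ k, ∑ l, R n j k l * ∑ a, ∑ b, R i a k b * R j l a b := by
    rw [ringR, sum_reorder, cyclicR]
    simp only [← Finset.sum_add_distrib, Finset.mul_sum]
    refine Finset.sum_congr rfl fun j _ ↦ Finset.sum_congr rfl fun k _ ↦
      Finset.sum_congr rfl fun l _ ↦ Finset.sum_congr rfl fun a _ ↦
        Finset.sum_congr rfl fun b _ ↦ ?_
    linear_combination R i a k b * R n j k l * (hR.pair_symm a j b l - hR.pair_symm j b l a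
      - hR.antisymm_right l a j b - hR.pair_symm j l a b - hR.antisymm_right a b j l
      + hR.bianchi l a b j)
  have h2 : ∑ j, ∑ k, ∑ l, R n j k l * ∑ a, ∑ b, R i a k b * R j l a b = hatR R i n / 4 := by
    simp only [fun k j l ↦ hR.sum_skew i k (R j l) (hR.antisymm_right j l)]
    rw [Finset.sum_comm]
    have h3 (k : ι) := hR.sum_skew n k (fun j l ↦ (∑ a, ∑ b, R i k a b * R j l a b) / 2)
      fun j l ↦ by simp only [hR.antisymm_left j l, mul_neg, Finset.sum_neg_distrib, neg_div]
    simp only [h3, hatR]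
    rw [Finset.sum_comm, Finset.sum_div]
    refine Finset.sum_congr rfl fun k _ ↦ ?_
    have h4 : ∑ a, ∑ c, ∑ u, ∑ v, R i k a c * R n k u v * R a c u v =
        ∑ u, ∑ v, ∑ a, ∑ c, R n k u v * (R i k a c * R u v a c) := by
      simp only [← Fintype.sum_prod_type']
      refine Fintype.sum_equiv ⟨fun p ↦ (p.2.2.1, p.2.2.2, p.1, p.2.1),
        fun p ↦ (p.2.2.1, p.2.2.2, p.1, p.2.1), fun _ ↦ rfl, fun _ ↦ rfl⟩ _ _ fun p ↦ ?_
      simp only [Equiv.coe_fn_mk]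
      rw [hR.pair_symm p.1]
      ring
    rw [h4]
    simp only [← Finset.mul_sum, mul_div_assoc', ← Finset.sum_div]
    ring
  rw [h1, h2]

/-- Pair symmetry moves the last slots of `R_abcu R_abcv` to the front, where their contraction is
`curvatureSq R u v`. -/
theorem checkR_eq (hR : IsAlgCurvature R) (i j : ι) :
    checkR R i j = ∑ u, ∑ v, R i u v j * curvatureSq R u v := by
  simp only [checkR, curvatureSq, Finset.mul_sum]
  refine Finset.sum_congr rfl fun u _ ↦ Finset.sum_congr rfl fun v _ ↦ ?_
  simp only [← Fintype.sum_prod_type']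
  refine Fintype.sum_equiv ⟨fun p ↦ (p.2.2, p.1, p.2.1), fun p ↦ (p.2.1, p.2.2, p.1),
    fun _ ↦ rfl, fun _ ↦ rfl⟩ _ _ fun p ↦ ?_
  simp only [Equiv.coe_fn_mk]
  rw [hR.pair_symm p.1 p.2.1 p.2.2 u, hR.pair_symm p.1 p.2.1 p.2.2 v, hR.antisymm_left p.2.2 u,
    hR.antisymm_left p.2.2 v]
  ring

variable [DecidableEq ι]

/-- The seven terms of `quadCurv` are contracted separately. The Einstein condition enters through
the traces of `R n j k l` against `g_jk` and `g_jl`; together with the term `3c R` they give the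
coefficient `5c`. -/
theorem sum_quadCurv_mul (hR : IsAlgCurvature R) {c : ℝ}
    (hc : ∀ i j, ricciComponents R i j = if i = j then c else 0) (i n : ι) :
    ∑ j, ∑ k, ∑ l, quadCurv R c i j k l * R n j k l =
      hatR R i n - 4 * cyclicR R i n + 5 * c * curvatureSq R i n + 2 * checkR R i n := by
  have e1 (p q : ι) : ∑ j, R p j j q = if p = q then c else 0 := by
    rw [← hc]
    exact Finset.sum_congr rfl fun j _ ↦ by
      rw [hR.antisymm_left, hR.antisymm_right, neg_neg]
  have e2 (p q : ι) : ∑ j, R p j q j = -if p = q then c else 0 := by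
    rw [← e1, ← Finset.sum_neg_distrib]
    exact Finset.sum_congr rfl fun j _ ↦ hR.antisymm_right ..
  have split (F₁ F₂ F₃ F₄ F₅ F₆ F₇ r : ι → ι → ι → ℝ) :
      ∑ j, ∑ k, ∑ l, (F₁ j k l - 2 * F₂ j k l + F₃ j k l + F₄ j k l + F₅ j k l - F₆ j k l
        - F₇ j k l) * r j k l =
      ∑ j, ∑ k, ∑ l, F₁ j k l * r j k l - 2 * ∑ j, ∑ k, ∑ l, F₂ j k l * r j k l
        + ∑ j, ∑ k, ∑ l, F₃ j k l * r j k l + ∑ j, ∑ k, ∑ l, F₄ j k l * r j k l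
        + ∑ j, ∑ k, ∑ l, F₅ j k l * r j k l - ∑ j, ∑ k, ∑ l, F₆ j k l * r j k l
        - ∑ j, ∑ k, ∑ l, F₇ j k l * r j k l := by
    simp only [add_mul, sub_mul, mul_assoc, Finset.sum_add_distrib, Finset.sum_sub_distrib,
      ← Finset.mul_sum]
  have t1 : ∑ j, ∑ k, ∑ l, (∑ a, ∑ b, R i j a b * R a b k l) * R n j k l = hatR R i n := by
    simp only [hatR, Finset.sum_mul]
    simp only [← Fintype.sum_prod_type']
    refine Fintype.sum_equiv ⟨fun p ↦ (p.2.2.2.1, p.1, p.2.2.2.2, p.2.1, p.2.2.1),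
      fun p ↦ (p.2.1, p.2.2.2.1, p.2.2.2.2, p.1, p.2.2.1), fun _ ↦ rfl, fun _ ↦ rfl⟩ _ _
      fun p ↦ ?_
    simp only [Equiv.coe_fn_mk]
    ring
  have t2 : ∑ j, ∑ k, ∑ l, (∑ a, ∑ b, (R i a k b * R j b l a - R j a k b * R i b l a)) *
      R n j k l = 2 * cyclicR R i n := by
    -- Exchange `k` with `l` and `a` with `b`, then use skewness of `R n j k l` in its last pair.
    have h : ∑ j, ∑ k, ∑ l, ∑ a, ∑ b, R j a k b * R i b l a * R n j k l = -cyclicR R i n := by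
      simp only [cyclicR, ← Finset.sum_neg_distrib]
      simp only [← Fintype.sum_prod_type']
      refine Fintype.sum_equiv ⟨fun p ↦ (p.1, p.2.2.1, p.2.1, p.2.2.2.2, p.2.2.2.1),
        fun p ↦ (p.1, p.2.2.1, p.2.1, p.2.2.2.2, p.2.2.2.1), fun _ ↦ rfl, fun _ ↦ rfl⟩ _ _
        fun p ↦ ?_
      simp only [Equiv.coe_fn_mk]
      rw [hR.antisymm_right n]
      ring
    simp only [Finset.sum_mul, sub_mul, Finset.sum_sub_distrib]
    rw [h, ← cyclicR]
    ring
  have t3 : ∑ j, ∑ k, ∑ l, (3 * c * R i j k l) * R n j k l = 3 * c * curvatureSq R i n := by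
    simp only [curvatureSq, mul_assoc, Finset.mul_sum]
  have t4 : ∑ j, ∑ k, ∑ l, (if j = k then curvatureSq R i l else 0) * R n j k l =
      c * curvatureSq R i n := by
    have (j : ι) : ∑ k, ∑ l, (if j = k then curvatureSq R i l else 0) * R n j k l =
        ∑ l, curvatureSq R i l * R n j j l := by
      rw [Finset.sum_comm]
      simp only [ite_mul, zero_mul, Finset.sum_ite_eq, Finset.mem_univ, if_true]
    simp only [this]
    rw [Finset.sum_comm]
    simp only [← Finset.mul_sum, e1, mul_ite, mul_zero, Finset.sum_ite_eq, Finset.mem_univ, if_true,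
      mul_comm c]
  have t5 : ∑ j, ∑ k, ∑ l, (if i = l then curvatureSq R j k else 0) * R n j k l =
      checkR R i n := by
    simp only [checkR_eq hR, ite_mul, zero_mul, Finset.sum_ite_eq, Finset.mem_univ, if_true]
    rw [Finset.sum_comm]
    refine Finset.sum_congr rfl fun u _ ↦ Finset.sum_congr rfl fun v _ ↦ ?_
    rw [curvatureSq_comm, hR.pair_symm n, hR.antisymm_left u i, hR.antisymm_right i u]
    ring
  have t6 : ∑ j, ∑ k, ∑ l, (if i = k then curvatureSq R j l else 0) * R n j k l =
      -checkR R i n := by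
    rw [← t5, ← Finset.sum_neg_distrib]
    refine Finset.sum_congr rfl fun u _ ↦ ?_
    rw [Finset.sum_comm]
    simp only [← Finset.sum_neg_distrib]
    refine Finset.sum_congr rfl fun v _ ↦ Finset.sum_congr rfl fun w _ ↦ ?_
    rw [hR.antisymm_right n, mul_neg]
  have t7 : ∑ j, ∑ k, ∑ l, (if j = l then curvatureSq R i k else 0) * R n j k l =
      -(c * curvatureSq R i n) := by
    rw [← t4, ← Finset.sum_neg_distrib]
    refine Finset.sum_congr rfl fun u _ ↦ ?_
    rw [Finset.sum_comm]
    simp only [← Finset.sum_neg_distrib]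
    refine Finset.sum_congr rfl fun v _ ↦ Finset.sum_congr rfl fun w _ ↦ ?_
    rw [hR.antisymm_right n, mul_neg]
  refine (split _ _ _ _ _ _ _ _).trans ?_
  rw [t1, t2, t3, t4, t5, t6, t7]
  ring

end Cubic

/-- The cubic identity for algebraic Einstein curvature tensors in dimension five. -/
theorem cubic_einstein_identity {R : Fin 5 → Fin 5 → Fin 5 → Fin 5 → ℝ} (hR : IsAlgCurvature R)
    {c : ℝ} (hc : ∀ i j, ricciComponents R i j = if i = j then c else 0) (i j : Fin 5) :
    (scalarCurvature R ^ 3 / 25 + scalarCurvature R / 5 * curvatureNormSq R)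
        * (if i = j then 1 else 0)
      - 2 * scalarCurvature R * curvatureSq R i j - 4 * checkR R i j - 4 * hatR R i j
      + 8 * ringR R i j = 0 := by
  have hτ : scalarCurvature R = 5 * c := by simp [scalarCurvature, hc]
  have h1 : ∑ k, R j k k i = if i = j then c else 0 := by
    rw [← hc]
    exact Finset.sum_congr rfl fun k _ ↦ by rw [hR.pair_symm]
  have h2 : ∑ k, R j k i k = -if i = j then c else 0 := by
    rw [← h1, ← Finset.sum_neg_distrib]
    exact Finset.sum_congr rfl fun k _ ↦ hR.antisymm_right ..
  have h := sum_quadCurv_mul hR hc i j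
  simp only [quadCurv_eq hR hc, mul_assoc, ← Finset.mul_sum, sub_mul, Finset.sum_sub_distrib,
    ite_mul, one_mul, zero_mul, mul_ite, mul_one, mul_zero, Finset.sum_ite_eq, Finset.mem_univ,
    if_true, h1, h2] at h
  rw [hτ, ringR_eq hR]
  -- With `ringR` expanded, `8 R̊ - 4 R̂` is `8 cyclicR - 2 R̂`, so the goal is twice the contracted
  -- identity.
  split_ifs at h ⊢ <;> linear_combination 2 * h

/-! ### Derivatives of functions along vector fields, obtained from Lie brackets. -/

section VectorFields

variable {E : Type*} [NormedAddCommGroup E] [NormedSpace ℝ E]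
  {H : Type*} [TopologicalSpace H] {I : ModelWithCorners ℝ E H}
  {M : Type*} [TopologicalSpace M] [ChartedSpace H M] [IsManifold I ∞ M]

open VectorField

theorem contMDiffAt_mlieBracket [CompleteSpace E] {X Y : Π x : M, TangentSpace I x} {x : M}
    (hX : CMDiffAt ∞ (T% X) x) (hY : CMDiffAt ∞ (T% Y) x) :
    CMDiffAt ∞ (T% (mlieBracket I X Y)) x := by
  have : IsManifold I ((⊤ : ℕ∞) + 1) M := by simpa using ‹IsManifold I ∞ M›
  have : IsManifold I (minSmoothness ℝ 2) M := by
    rw [minSmoothness_of_isRCLikeNormedField]; infer_instance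
  exact ContMDiffAt.mlieBracket_vectorField (m := ⊤) (n := ⊤) hX hY (by simp)

theorem eventually_mdifferentiableAt {f : M → ℝ} {x : M} (hf : CMDiffAt ∞ f x) :
    ∀ᶠ y in 𝓝 x, MDiffAt f y := by
  filter_upwards [(contMDiffAt_iff_contMDiffAt_nhds (by simp)).1
    (hf.of_le (by simp : (1 : ℕ∞ω) ≤ ∞))] with y hy using hy.mdifferentiableAt one_ne_zero

theorem eventually_mdifferentiableAt_section {X : Π x : M, TangentSpace I x} {x : M}
    (hX : CMDiffAt ∞ (T% X) x) : ∀ᶠ y in 𝓝 x, MDiffAt (T% X) y := by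
  filter_upwards [(contMDiffAt_iff_contMDiffAt_nhds (by simp)).1
    (hX.of_le (by simp : (1 : ℕ∞ω) ≤ ∞))] with y hy using hy.mdifferentiableAt one_ne_zero

variable [RiemannianBundle (fun x : M ↦ TangentSpace I x)]
  [IsContMDiffRiemannianBundle I ∞ E (fun x : M ↦ TangentSpace I x)]

theorem contMDiffAt_inner {Y Z : Π x : M, TangentSpace I x} {x : M} {n : ℕ∞}
    (hY : CMDiffAt n (T% Y) x) (hZ : CMDiffAt n (T% Z) x) :
    CMDiffAt n (fun y ↦ (inner ℝ (Y y) (Z y) : ℝ)) x := by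
  have : IsContMDiffRiemannianBundle I n E (fun x : M ↦ TangentSpace I x) :=
    .of_le (n := ∞) (by exact_mod_cast le_top)
  exact ContMDiffAt.inner_bundle (E := fun x : M ↦ TangentSpace I x) (F := E) (IB := I)
    (b := fun x : M ↦ x) (v := Y) (w := Z) (x := x) (IM := I) hY hZ

variable [FiniteDimensional ℝ E]

/-- For a smooth `Z` with `Z x ≠ 0`, the rule `[Y, fZ] = (Yf) Z + f [Y, Z]` gives `Yf = (g([Y, fZ],
Z) - f g([Y, Z], Z)) / g(Z, Z)` near `x`, a quotient of smooth functions. -/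
theorem contMDiffAt_mvfderiv [Nontrivial E] {f : M → ℝ} {Y : Π x : M, TangentSpace I x} {x : M}
    (hf : CMDiffAt ∞ f x) (hY : CMDiffAt ∞ (T% Y) x) :
    CMDiffAt ∞ (fun y ↦ mvfderiv I f y (Y y)) x := by
  obtain ⟨z, hz⟩ := exists_ne (0 : E)
  have hz' : (z : TangentSpace I x) ≠ 0 := hz
  set Z : Π x : M, TangentSpace I x := FiberBundle.extend E (z : TangentSpace I x) with hZdef
  have hZ : CMDiffAt ∞ (T% Z) x := FiberBundle.contMDiffAt_extend I E _
  have hZx : Z x = z := FiberBundle.extend_apply_self ..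
  have hfZ : CMDiffAt ∞ (T% (f • Z)) x := hf.smul_section hZ
  have h1 : CMDiffAt ∞ (fun y ↦ (inner ℝ (mlieBracket I Y (f • Z) y) (Z y) : ℝ)) x :=
    contMDiffAt_inner (n := ⊤) (contMDiffAt_mlieBracket hY hfZ) hZ
  have h2 : CMDiffAt ∞ (fun y ↦ (inner ℝ (mlieBracket I Y Z y) (Z y) : ℝ)) x :=
    contMDiffAt_inner (n := ⊤) (contMDiffAt_mlieBracket hY hZ) hZ
  have h3 : CMDiffAt ∞ (fun y ↦ (inner ℝ (Z y) (Z y) : ℝ)) x := contMDiffAt_inner (n := ⊤) hZ hZ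
  have h4 : (inner ℝ (Z x) (Z x) : ℝ) ≠ 0 := by rw [hZx]; exact inner_self_ne_zero.2 hz'
  refine ((h1.sub (hf.mul h2)).div₀ h3 h4).congr_of_eventuallyEq ?_
  filter_upwards [h3.continuousAt.eventually_ne h4, eventually_mdifferentiableAt_section hZ,
    eventually_mdifferentiableAt hf]
    with y hy hZy hfy
  simp only [Pi.div_apply, Pi.mul_apply]
  rw [mlieBracket_smul_right hfy hZy, inner_add_left, real_inner_smul_left, real_inner_smul_left]
  field_simp
  ring

/-- `X (Y f) - Y (X f) = [X, Y] f`, deduced from the Jacobi identity for `X`, `Y` and `f • Z`. -/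
theorem mvfderiv_mvfderiv_sub [Nontrivial E] {f : M → ℝ} {X Y : Π x : M, TangentSpace I x} {x : M}
    (hf : CMDiffAt ∞ f x) (hX : CMDiffAt ∞ (T% X) x) (hY : CMDiffAt ∞ (T% Y) x) :
    mvfderiv I (fun y ↦ mvfderiv I f y (Y y)) x (X x)
      - mvfderiv I (fun y ↦ mvfderiv I f y (X y)) x (Y x) =
      mvfderiv I f x (mlieBracket I X Y x) := by
  obtain ⟨z, hz⟩ := exists_ne (0 : E)
  have hz' : (z : TangentSpace I x) ≠ 0 := hz
  set Z : Π x : M, TangentSpace I x := FiberBundle.extend E (z : TangentSpace I x) with hZdef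
  have hZ : CMDiffAt ∞ (T% Z) x := FiberBundle.contMDiffAt_extend I E _
  have hZx : Z x = z := FiberBundle.extend_apply_self ..
  have hfZ : CMDiffAt ∞ (T% (f • Z)) x := hf.smul_section hZ
  have expand {U : Π x : M, TangentSpace I x} (hU : CMDiffAt ∞ (T% U) x) :
      mlieBracket I U (f • Z) =ᶠ[𝓝 x]
        (fun y ↦ mvfderiv I f y (U y)) • Z + f • mlieBracket I U Z := by
    filter_upwards [eventually_mdifferentiableAt_section hZ, eventually_mdifferentiableAt hf]
      with y hZy hfy
    rw [mlieBracket_smul_right hfy hZy]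
    rfl
  have hfx : MDiffAt f x := hf.mdifferentiableAt (by simp)
  have hZx' : MDiffAt (T% Z) x := hZ.mdifferentiableAt (by simp)
  have twice {U V : Π x : M, TangentSpace I x} (hU : CMDiffAt ∞ (T% U) x)
      (hV : CMDiffAt ∞ (T% V) x) : mlieBracket I U (mlieBracket I V (f • Z)) x =
        mvfderiv I (fun y ↦ mvfderiv I f y (V y)) x (U x) • Z x
          + mvfderiv I f x (V x) • mlieBracket I U Z x + mvfderiv I f x (U x) • mlieBracket I V Z x
          + f x • mlieBracket I U (mlieBracket I V Z) x := by
    have hVf := (contMDiffAt_mvfderiv hf hV).mdifferentiableAt (by simp)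
    have hVZ : MDiffAt (T% (mlieBracket I V Z)) x :=
      (contMDiffAt_mlieBracket hV hZ).mdifferentiableAt (by simp)
    rw [Filter.EventuallyEq.rfl.mlieBracket_vectorField_eq (expand hV),
      mlieBracket_add_right (hVf.smul_section hZx') (hfx.smul_section hVZ),
      mlieBracket_smul_right hVf hZx', mlieBracket_smul_right hfx hVZ]
    module
  have : IsManifold I (minSmoothness ℝ 3) M := by
    rw [minSmoothness_of_isRCLikeNormedField]; infer_instance
  have le2 : minSmoothness ℝ 2 ≤ ∞ := by
    rw [minSmoothness_of_isRCLikeNormedField]; exact ENat.LEInfty.out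
  have jacobi := leibniz_identity_mlieBracket_apply (hX.of_le le2) (hY.of_le le2) (hfZ.of_le le2)
  have jacobi' := leibniz_identity_mlieBracket_apply (hX.of_le le2) (hY.of_le le2) (hZ.of_le le2)
  rw [twice hX hY, twice hY hX, mlieBracket_smul_right hfx hZx', jacobi'] at jacobi
  -- Jacobi for `X, Y, fZ` minus `f` times Jacobi for `X, Y, Z`; the first-order terms in `f` that
  -- multiply brackets with `Z` cancel.
  have key : (mvfderiv I (fun y ↦ mvfderiv I f y (Y y)) x (X x)
      - mvfderiv I (fun y ↦ mvfderiv I f y (X y)) x (Y x)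
      - mvfderiv I f x (mlieBracket I X Y x)) • Z x = 0 := by
    rw [← sub_eq_zero.2 jacobi]
    module
  rw [hZx] at key
  exact sub_eq_zero.1 ((smul_eq_zero.1 key).resolve_right hz')

end VectorFields

/-! ### Differentiability of sections from their inner products. -/

section LeviCivitaSmooth

variable {E : Type*} [NormedAddCommGroup E] [NormedSpace ℝ E]
  {H : Type*} [TopologicalSpace H] {I : ModelWithCorners ℝ E H}
  {M : Type*} [TopologicalSpace M] [ChartedSpace H M]

theorem mdifferentiableAt_sum_smul {F : Type*} {ι : Type} [NormedAddCommGroup F] [NormedSpace ℝ F]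
    [Fintype ι] {f : ι → M → ℝ} {x : M} (hf : ∀ i, MDiffAt (f i) x) (v : ι → F) :
    MDiffAt (fun y ↦ ∑ i, f i y • v i) x := by
  have : (fun y ↦ ∑ i, f i y • v i) = ∑ i, (f i • fun _ ↦ v i) := by ext; simp
  rw [this]
  have h (i : ι) : MDiffAt (f i • fun _ : M ↦ v i) x := (hf i).smul mdifferentiableAt_const
  exact MDifferentiableAt.sum fun i _ ↦ h i

variable [IsManifold I ∞ M]
  [RiemannianBundle (fun x : M ↦ TangentSpace I x)]
  [IsContMDiffRiemannianBundle I ∞ E (fun x : M ↦ TangentSpace I x)]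
  [FiniteDimensional ℝ E]

open VectorField

theorem contMDiffAt_koszul [Nontrivial E] {X Y Z : Π x : M, TangentSpace I x} {x : M}
    (hX : CMDiffAt ∞ (T% X) x) (hY : CMDiffAt ∞ (T% Y) x) (hZ : CMDiffAt ∞ (T% Z) x) :
    CMDiffAt ∞ (koszul I X Y Z) x := by
  have d {U V W : Π x : M, TangentSpace I x} (hU : CMDiffAt ∞ (T% U) x)
      (hV : CMDiffAt ∞ (T% V) x) (hW : CMDiffAt ∞ (T% W) x) :
      CMDiffAt ∞ (fun y ↦ mvfderiv I (fun z ↦ (inner ℝ (V z) (W z) : ℝ)) y (U y)) x :=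
    contMDiffAt_mvfderiv (contMDiffAt_inner (n := ⊤) hV hW) hU
  have b {U V W : Π x : M, TangentSpace I x} (hU : CMDiffAt ∞ (T% U) x)
      (hV : CMDiffAt ∞ (T% V) x) (hW : CMDiffAt ∞ (T% W) x) :
      CMDiffAt ∞ (fun y ↦ (inner ℝ (mlieBracket I U V y) (W y) : ℝ)) x :=
    contMDiffAt_inner (n := ⊤) (contMDiffAt_mlieBracket hU hV) hW
  exact (((((d hX hY hZ).add (d hY hX hZ)).sub (d hZ hX hY)).add (b hX hY hZ)).sub
    (b hX hZ hY)).sub (b hY hZ hX)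

/-- A section of the tangent bundle is differentiable if its inner products with all
smooth vector fields are. -/
theorem mdifferentiableAt_of_inner {s : Π x : M, TangentSpace I x} {x : M}
    (h : ∀ W : Π x : M, TangentSpace I x, CMDiffAt ∞ (T% W) x →
      MDiffAt (fun y ↦ (inner ℝ (s y) (W y) : ℝ)) x) : MDiffAt (T% s) x := by
  set e := trivializationAt E (TangentSpace I : M → Type _) x
  have hx : x ∈ e.baseSet := FiberBundle.mem_baseSet_trivializationAt' x
  set b := Module.finBasis ℝ E
  set W := e.localFrame b
  have hW (i) : CMDiffAt ∞ (T% (W i)) x := contMDiffAt_localFrame_of_mem ∞ e b i hx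
  -- The Gram matrix of the local frame `W`. It sends the frame coefficients `c` of `s` to the inner
  -- products `w`, so near `x` the coefficients are recovered as `G⁻¹ w`.
  let G (y : M) : (Fin (Module.finrank ℝ E) → ℝ) →L[ℝ] (Fin (Module.finrank ℝ E) → ℝ) :=
    ∑ i, ∑ j, (inner ℝ (W i y) (W j y) : ℝ) •
      ((ContinuousLinearMap.proj (R := ℝ) i).smulRight (Pi.single j (1 : ℝ)))
  have hGapply (y : M) (c) (j) : G y c j = inner ℝ (∑ i, c i • W i y) (W j y) := by
    simp [G, sum_inner, real_inner_smul_left, Finset.sum_apply, Pi.single_apply, mul_comm]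
  have hG : MDiffAt G x := by
    have := mdifferentiableAt_sum_smul (x := x)
      (f := fun (p : _ × _) y ↦ (inner ℝ (W p.1 y) (W p.2 y) : ℝ))
      (fun p ↦ mdifferentiableAt_inner ((hW p.1).mdifferentiableAt (by simp))
        ((hW p.2).mdifferentiableAt (by simp)))
      fun p ↦ (ContinuousLinearMap.proj (R := ℝ) (φ := fun _ ↦ ℝ) p.1).smulRight
        (Pi.single p.2 (1 : ℝ) : Fin (Module.finrank ℝ E) → ℝ)
    simpa only [G, ← Fintype.sum_prod_type'] using this
  have hlin : LinearIndependent ℝ (fun i ↦ W i x) :=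
    (e.isLocalFrameOn_localFrame_baseSet I ∞ b).linearIndependent hx
  have hunit : IsUnit (G x) := by
    rw [ContinuousLinearMap.isUnit_iff_bijective]
    have hinj : Function.Injective (G x) := by
      rw [injective_iff_map_eq_zero]
      intro c hc
      -- A vector in the kernel of the Gram matrix gives a combination of the frame orthogonal to
      -- itself.
      have h0 : (inner ℝ (∑ i, c i • W i x) (∑ i, c i • W i x) : ℝ) = 0 := by
        rw [inner_sum]
        simp [real_inner_smul_right, ← hGapply, hc]
      rw [inner_self_eq_zero] at h0
      exact funext (Fintype.linearIndependent_iff.1 hlin c h0)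
    exact ⟨hinj, (LinearMap.injective_iff_surjective (f := (G x).toLinearMap)).1 hinj⟩
  let c (y : M) (i : Fin (Module.finrank ℝ E)) : ℝ := e.localFrameCoeff I b i y (s y)
  let w (y : M) (j : Fin (Module.finrank ℝ E)) : ℝ := inner ℝ (s y) (W j y)
  have hw : MDifferentiableAt I 𝓘(ℝ, Fin (Module.finrank ℝ E) → ℝ) w x := by
    have hsum : w = fun y ↦ ∑ j, (inner ℝ (s y) (W j y) : ℝ) •
        (Pi.single j (1 : ℝ) : Fin (Module.finrank ℝ E) → ℝ) := by
      ext y j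
      simp [w, Finset.sum_apply, Pi.single_apply]
    rw [hsum]
    exact mdifferentiableAt_sum_smul (fun j ↦ h (W j) (hW j)) _
  -- `Ring.inverse` is a true inverse only at units; these form an open set, so this holds for all
  -- `y` near `x`.
  have hinv : MDiffAt (fun y ↦ Ring.inverse (G y)) x :=
    (differentiableAt_inverse hunit).comp_mdifferentiableAt hG
  have hc : MDifferentiableAt I 𝓘(ℝ, Fin (Module.finrank ℝ E) → ℝ) c x := by
    have := hinv.clm_apply hw
    refine this.congr_of_eventuallyEq ?_
    have hu : ∀ᶠ y in 𝓝 x, IsUnit (G y) :=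
      hG.continuousAt.eventually (Units.isOpen.mem_nhds hunit)
    filter_upwards [hu, e.open_baseSet.mem_nhds hx] with y hy hyx
    have : w y = G y (c y) := by
      ext j
      rw [hGapply, ← e.eq_sum_localFrameCoeff_smul hyx]
    rw [this]
    change c y = (Ring.inverse (G y) * G y) (c y)
    rw [Ring.inverse_mul_cancel _ hy]
    rfl
  rw [mdifferentiableAt_iff_localFrameCoeff b hx]
  intro i
  exact (ContinuousLinearMap.proj (R := ℝ) (φ := fun _ ↦ ℝ)
    i).differentiable.comp_mdifferentiableAt hc

end LeviCivitaSmooth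

/-! ### Symmetries of the Riemannian curvature tensor. -/

section Curvature

variable {E : Type*} [NormedAddCommGroup E] [NormedSpace ℝ E]
  {H : Type*} [TopologicalSpace H] {I : ModelWithCorners ℝ E H}
  {M : Type*} [TopologicalSpace M] [ChartedSpace H M]

open VectorField

theorem mvfderiv_congr {f g : M → ℝ} {x : M} (h : f =ᶠ[𝓝 x] g) :
    mvfderiv I f x = mvfderiv I g x := by
  ext v
  change mfderiv I 𝓘(ℝ, ℝ) f x v = mfderiv I 𝓘(ℝ, ℝ) g x v
  rw [h.mfderiv_eq]
  rfl

variable [IsManifold I ∞ M]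

/-- On the base set of the trivialization the extension depends linearly on `u`. Hence
`FiberBundle.extend` is additive and homogeneous near `x`. -/
theorem extend_eq_symmₗ {x y : M} (u : TangentSpace I x)
    (hy : y ∈ (trivializationAt E (TangentSpace I : M → Type _) x).baseSet) :
    (FiberBundle.extend E u y : TangentSpace I y) =
      (trivializationAt E (TangentSpace I) x).symmₗ ℝ y
        ((trivializationAt E (TangentSpace I) x).linearEquivAt ℝ x
          (FiberBundle.mem_baseSet_trivializationAt' x) u) := by
  rw [Trivialization.symmₗ_apply _ hy]
  rfl

theorem eventually_mem_baseSet (x : M) :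
    ∀ᶠ y in 𝓝 x, y ∈ (trivializationAt E (TangentSpace I : M → Type _) x).baseSet :=
  (trivializationAt E (TangentSpace I : M → Type _) x).open_baseSet.mem_nhds
    (FiberBundle.mem_baseSet_trivializationAt' x)

theorem extend_add {x : M} (u v : TangentSpace I x) :
    (FiberBundle.extend E (u + v) : Π y : M, TangentSpace I y) =ᶠ[𝓝 x]
      FiberBundle.extend E u + FiberBundle.extend E v := by
  filter_upwards [eventually_mem_baseSet (I := I) x] with y hy
  simp only [Pi.add_apply, extend_eq_symmₗ _ hy, map_add]
  rfl

theorem extend_smul {x : M} (c : ℝ) (v : TangentSpace I x) :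
    (FiberBundle.extend E (c • v) : Π y : M, TangentSpace I y) =ᶠ[𝓝 x]
      c • FiberBundle.extend E v := by
  filter_upwards [eventually_mem_baseSet (I := I) x] with y hy
  simp only [Pi.smul_apply, extend_eq_symmₗ _ hy, map_smul]
  rfl

theorem contMDiffAt_extend (x : M) (u : TangentSpace I x) :
    CMDiffAt ∞ (T% (FiberBundle.extend E u : Π y : M, TangentSpace I y)) x :=
  FiberBundle.contMDiffAt_extend I E _

variable
  [RiemannianBundle (fun x : M ↦ TangentSpace I x)]
  [IsContMDiffRiemannianBundle I ∞ E (fun x : M ↦ TangentSpace I x)]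
  [FiniteDimensional ℝ E]

/-- By the Koszul formula the inner products of `∇_X Y` with smooth fields are half of `koszul` near
`x`, which is smooth. -/
theorem mdifferentiableAt_leviCivita [Nontrivial E] {X Y : Π x : M, TangentSpace I x} {x : M}
    (hX : CMDiffAt ∞ (T% X) x) (hY : CMDiffAt ∞ (T% Y) x) :
    MDiffAt (T% (fun y ↦ leviCivita I M Y y (X y))) x := by
  refine mdifferentiableAt_of_inner fun W hW ↦ ?_
  have hk : MDiffAt (fun y ↦ 1 / 2 * koszul I X Y W y) x :=
    (contMDiffAt_const.mul (contMDiffAt_koszul hX hY hW)).mdifferentiableAt (by simp)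
  refine hk.congr_of_eventuallyEq ?_
  filter_upwards [eventually_mdifferentiableAt_section hX, eventually_mdifferentiableAt_section hY,
    eventually_mdifferentiableAt_section hW] with y h1 h2 h3
  exact inner_leviCivitaFun_eq_koszul h1 h2 h3

theorem leviCivita_sub_swap {X Y : Π x : M, TangentSpace I x} {x : M}
    (hX : MDiffAt (T% X) x) (hY : MDiffAt (T% Y) x) :
    leviCivita I M Y x (X x) - leviCivita I M X x (Y x) = mlieBracket I X Y x :=
  (CovariantDerivative.torsion_eq_zero_iff _).1 leviCivita_torsion hX hY

theorem leviCivita_sub {Y Z : Π x : M, TangentSpace I x} {x : M}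
    (hY : MDiffAt (T% Y) x) (hZ : MDiffAt (T% Z) x) :
    leviCivita I M (Y - Z) x = leviCivita I M Y x - leviCivita I M Z x := by
  have h := (leviCivita I M).isCovariantDerivativeOnUniv.add (x := x) (σ := Y - Z) (σ' := Z)
    (mdifferentiableAt_sub_section hY hZ) hZ
  rw [sub_add_cancel] at h
  exact eq_sub_of_add_eq h.symm

theorem leviCivita_congr {Y Z : Π x : M, TangentSpace I x} {x : M}
    (hY : MDiffAt (T% Y) x) (hZ : MDiffAt (T% Z) x) (h : ∀ᶠ y in 𝓝 x, Y y = Z y) :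
    leviCivita I M Y x = leviCivita I M Z x :=
  (leviCivita I M).isCovariantDerivativeOnUniv.congr_of_eventuallyEq hY hZ Filter.univ_mem h

theorem curvatureField_swap (X Y Z : Π x : M, TangentSpace I x) (x : M) :
    curvatureField I X Y Z x = -curvatureField I Y X Z x := by
  simp only [curvatureField]
  rw [mlieBracket_swap_apply (V := X), map_neg]
  abel

/-- The first Bianchi identity. -/
theorem curvatureField_bianchi [Nontrivial E] {X Y Z : Π x : M, TangentSpace I x} {x : M}
    (hX : CMDiffAt ∞ (T% X) x) (hY : CMDiffAt ∞ (T% Y) x) (hZ : CMDiffAt ∞ (T% Z) x) :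
    curvatureField I X Y Z x + curvatureField I Y Z X x + curvatureField I Z X Y x = 0 := by
  -- Vanishing torsion, used twice: `∇_U (∇_V W - ∇_W V) - ∇_[V,W] U = ∇_U [V,W] - ∇_[V,W] U =
  -- [U,[V,W]]`. The cyclic sum then vanishes by the Jacobi identity.
  have key {U V W : Π x : M, TangentSpace I x} (hU : CMDiffAt ∞ (T% U) x)
      (hV : CMDiffAt ∞ (T% V) x) (hW : CMDiffAt ∞ (T% W) x) :
      leviCivita I M (fun y ↦ leviCivita I M W y (V y)) x (U x)
        - leviCivita I M (fun y ↦ leviCivita I M V y (W y)) x (U x)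
        - leviCivita I M U x (mlieBracket I V W x) = mlieBracket I U (mlieBracket I V W) x := by
    have hVW : MDiffAt (T% (mlieBracket I V W)) x :=
      (contMDiffAt_mlieBracket hV hW).mdifferentiableAt (by simp)
    have h1 := mdifferentiableAt_leviCivita hV hW
    have h2 := mdifferentiableAt_leviCivita hW hV
    rw [← leviCivita_sub_swap (hU.mdifferentiableAt (by simp)) hVW,
      leviCivita_congr hVW (mdifferentiableAt_sub_section h1 h2), leviCivita_sub h1 h2]
    · rfl
    · filter_upwards [eventually_mdifferentiableAt_section hV,
        eventually_mdifferentiableAt_section hW] with y h3 h4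
      exact (leviCivita_sub_swap h3 h4).symm
  have : IsManifold I (minSmoothness ℝ 3) M := by
    rw [minSmoothness_of_isRCLikeNormedField]; infer_instance
  have le2 : minSmoothness ℝ 2 ≤ ∞ := by
    rw [minSmoothness_of_isRCLikeNormedField]; exact ENat.LEInfty.out
  have jacobi := leibniz_identity_mlieBracket_apply (hX.of_le le2) (hY.of_le le2) (hZ.of_le le2)
  rw [mlieBracket_swap_apply (V := mlieBracket I X Y), mlieBracket_swap (V := X) (W := Z),
    ← sub_eq_zero] at jacobi
  have hneg : mlieBracket I Y (-mlieBracket I Z X) x = -mlieBracket I Y (mlieBracket I Z X) x := by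
    simpa using mlieBracket_const_smul_right (V := Y) (c := (-1 : ℝ))
      ((contMDiffAt_mlieBracket hZ hX).mdifferentiableAt (by simp))
  rw [hneg, ← key hX hY hZ, ← key hY hZ hX, ← key hZ hX hY] at jacobi
  rw [← jacobi]
  simp only [curvatureField]
  abel

/-- The curvature operator `R(X, Y)` is skew-adjoint. -/
theorem inner_curvatureField_add_swap [Nontrivial E] {X Y Z W : Π x : M, TangentSpace I x} {x : M}
    (hX : CMDiffAt ∞ (T% X) x) (hY : CMDiffAt ∞ (T% Y) x) (hZ : CMDiffAt ∞ (T% Z) x)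
    (hW : CMDiffAt ∞ (T% W) x) :
    (inner ℝ (curvatureField I X Y Z x) (W x) : ℝ)
      + inner ℝ (Z x) (curvatureField I X Y W x) = 0 := by
  have d {U : Π x : M, TangentSpace I x} (hU : CMDiffAt ∞ (T% U) x) : MDiffAt (T% U) x :=
    hU.mdifferentiableAt (by simp)
  -- Metric compatibility applied twice to `g(Z, W)`. The two mixed terms are exchanged when `U` and
  -- `V` are, so they drop out of the commutator `X Y - Y X`, which equals `[X, Y]` on `g(Z, W)`.
  have twice {U V : Π x : M, TangentSpace I x} (hU : CMDiffAt ∞ (T% U) x)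
      (hV : CMDiffAt ∞ (T% V) x) :
      mvfderiv I (fun y ↦ mvfderiv I (fun z ↦ (inner ℝ (Z z) (W z) : ℝ)) y (V y)) x (U x) =
        inner ℝ (leviCivita I M (fun y ↦ leviCivita I M Z y (V y)) x (U x)) (W x)
        + inner ℝ (leviCivita I M Z x (V x)) (leviCivita I M W x (U x))
        + (inner ℝ (leviCivita I M Z x (U x)) (leviCivita I M W x (V x))
        + inner ℝ (Z x) (leviCivita I M (fun y ↦ leviCivita I M W y (V y)) x (U x))) := by
    have hVZ := mdifferentiableAt_leviCivita hV hZ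
    have hVW := mdifferentiableAt_leviCivita hV hW
    have hcongr : (fun y ↦ mvfderiv I (fun z ↦ (inner ℝ (Z z) (W z) : ℝ)) y (V y)) =ᶠ[𝓝 x]
        (fun y ↦ (inner ℝ (leviCivita I M Z y (V y)) (W y) : ℝ))
          + fun y ↦ (inner ℝ (Z y) (leviCivita I M W y (V y)) : ℝ) := by
      filter_upwards [eventually_mdifferentiableAt_section hV,
        eventually_mdifferentiableAt_section hZ, eventually_mdifferentiableAt_section hW]
        with y h1 h2 h3 using leviCivita_metric h1 h2 h3
    have h := leviCivita_metric (d hU) hVZ (d hW)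
    have h' := leviCivita_metric (d hU) (d hZ) hVW
    rw [← h, ← h', ← add_apply, ← mvfderiv_add (mdifferentiableAt_inner hVZ (d hW))
      (mdifferentiableAt_inner (d hZ) hVW)]
    rw [mvfderiv_congr hcongr]
  have hlie : MDiffAt (T% (mlieBracket I X Y)) x := d (contMDiffAt_mlieBracket hX hY)
  have h1 := mvfderiv_mvfderiv_sub (contMDiffAt_inner (n := ⊤) hZ hW) hX hY
  rw [twice hX hY, twice hY hX, leviCivita_metric hlie (d hZ) (d hW)] at h1
  simp only [curvatureField, inner_sub_left, inner_sub_right]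
  linarith

/-- Needed because the extension of a sum or a multiple agrees with the sum or multiple of the
extensions only near `x`. -/
theorem curvatureField_congr_left [Nontrivial E] {X X' Y Z : Π x : M, TangentSpace I x} {x : M}
    (hX : CMDiffAt ∞ (T% X) x) (hX' : CMDiffAt ∞ (T% X') x) (hZ : CMDiffAt ∞ (T% Z) x)
    (h : X =ᶠ[𝓝 x] X') : curvatureField I X Y Z x = curvatureField I X' Y Z x := by
  simp only [curvatureField]
  rw [h.mlieBracket_vectorField_eq (W := Y) Filter.EventuallyEq.rfl, h.eq_of_nhds,
    leviCivita_congr (mdifferentiableAt_leviCivita hX hZ) (mdifferentiableAt_leviCivita hX' hZ)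
      (h.mono fun y hy ↦ congrArg (leviCivita I M Z y) hy)]

theorem curvatureField_add_left [Nontrivial E] {X X' Y Z : Π x : M, TangentSpace I x} {x : M}
    (hX : CMDiffAt ∞ (T% X) x) (hX' : CMDiffAt ∞ (T% X') x) (hZ : CMDiffAt ∞ (T% Z) x) :
    curvatureField I (X + X') Y Z x = curvatureField I X Y Z x + curvatureField I X' Y Z x := by
  have h : leviCivita I M (fun y ↦ leviCivita I M Z y ((X + X') y)) x = _ :=
    Eq.trans (congrArg (fun σ ↦ leviCivita I M σ x) (funext fun y ↦ map_add _ _ _))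
      ((leviCivita I M).isCovariantDerivativeOnUniv.add (x := x)
        (mdifferentiableAt_leviCivita hX hZ) (mdifferentiableAt_leviCivita hX' hZ))
  simp only [curvatureField]
  rw [mlieBracket_add_left (hX.mdifferentiableAt (by simp)) (hX'.mdifferentiableAt (by simp)), h,
    Pi.add_apply, map_add, map_add, add_apply]
  abel

theorem curvatureField_smul_left [Nontrivial E] {X Y Z : Π x : M, TangentSpace I x} {x : M}
    (c : ℝ) (hX : CMDiffAt ∞ (T% X) x) (hZ : CMDiffAt ∞ (T% Z) x) :
    curvatureField I (c • X) Y Z x = c • curvatureField I X Y Z x := by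
  have h : leviCivita I M (fun y ↦ leviCivita I M Z y ((c • X) y)) x = _ :=
    Eq.trans (congrArg (fun σ ↦ leviCivita I M σ x) (funext fun y ↦ map_smul _ _ _))
      ((leviCivita I M).isCovariantDerivativeOnUniv.smul_const (x := x) c
        (mdifferentiableAt_leviCivita hX hZ))
  simp only [curvatureField]
  rw [mlieBracket_const_smul_left (hX.mdifferentiableAt (by simp)), h, Pi.smul_apply, map_smul,
    map_smul, smul_apply]
  module

theorem curvature_add_left [Nontrivial E] (x : M) (u u' v w : TangentSpace I x) :
    curvature I x (u + u') v w = curvature I x u v w + curvature I x u' v w := by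
  have s := contMDiffAt_extend (I := I) x
  simp only [curvature]
  rw [curvatureField_congr_left (s _) ((s u).add_section (s u')) (s w) (extend_add u u'),
    curvatureField_add_left (s u) (s u') (s w)]

theorem curvature_smul_left [Nontrivial E] (x : M) (c : ℝ) (u v w : TangentSpace I x) :
    curvature I x (c • u) v w = c • curvature I x u v w := by
  have s := contMDiffAt_extend (I := I) x
  simp only [curvature]
  rw [curvatureField_congr_left (s _) ((s u).const_smul_section (a := c)) (s w)
    (extend_smul c u), curvatureField_smul_left c (s u) (s w)]

theorem isAlgCurvature_curvatureComponents [Nontrivial E] {ι : Type*} [Fintype ι] {x : M}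
    (e : OrthonormalBasis ι ℝ (TangentSpace I x)) : IsAlgCurvature (curvatureComponents I e) where
  antisymm_left a b c d := by
    rw [curvatureComponents, curvature, curvatureField_swap, inner_neg_left]
    rfl
  antisymm_right a b c d := by
    have s := contMDiffAt_extend (I := I) x
    have h := inner_curvatureField_add_swap (s (e a)) (s (e b)) (s (e c)) (s (e d))
    simp only [FiberBundle.extend_apply_self] at h
    rw [real_inner_comm (curvatureField _ _ _ _ _)] at h
    exact eq_neg_of_add_eq_zero_left h
  bianchi a b c d := by
    have s := contMDiffAt_extend (I := I) x
    simp only [curvatureComponents, curvature, ← inner_add_left]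
    rw [curvatureField_bianchi (s (e a)) (s (e b)) (s (e c)), inner_zero_left]

/-- The Ricci tensor may be computed with any orthonormal basis. -/
theorem ricciComponents_curvatureComponents [Nontrivial E] {ι : Type*} [Fintype ι] {x : M}
    (e : OrthonormalBasis ι ℝ (TangentSpace I x)) (i j : ι) :
    ricciComponents (curvatureComponents I e) i j = ricci I x (e i) (e j) := by
  -- Linearity in the first slot makes the Ricci tensor the trace of an endomorphism, which any
  -- orthonormal basis computes.
  let T : TangentSpace I x →ₗ[ℝ] TangentSpace I x :=
    { toFun := fun u ↦ curvature I x u (e i) (e j)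
      map_add' := fun u u' ↦ curvature_add_left x u u' _ _
      map_smul' := fun c u ↦ curvature_smul_left x c u _ _ }
  have h : ricciComponents (curvatureComponents I e) i j = ∑ a, inner ℝ (e a) (T (e a)) :=
    Finset.sum_congr rfl fun a _ ↦ real_inner_comm _ _
  have h' : ricci I x (e i) (e j) = ∑ a, inner ℝ (stdOrthonormalBasis ℝ (TangentSpace I x) a)
      (T (stdOrthonormalBasis ℝ (TangentSpace I x) a)) :=
    Finset.sum_congr rfl fun a _ ↦ real_inner_comm _ _
  rw [h, h', ← LinearMap.trace_eq_sum_inner, ← LinearMap.trace_eq_sum_inner]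

end Curvature

end RiemGeom

theorem mainTheorem12 {M : Type*} [TopologicalSpace M]
    [ChartedSpace (EuclideanSpace ℝ (Fin 5)) M] [IsManifold (𝓡 5) ∞ M]
    [RiemannianBundle (fun x : M ↦ TangentSpace (𝓡 5) x)]
    [IsContMDiffRiemannianBundle (𝓡 5) ∞ (EuclideanSpace ℝ (Fin 5))
      (fun x : M ↦ TangentSpace (𝓡 5) x)]
    (hM : RiemGeom.IsEinstein (𝓡 5) M)
    (x : M) (e : OrthonormalBasis (Fin 5) ℝ (TangentSpace (𝓡 5) x)) (i j : Fin 5) :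
    let R := RiemGeom.curvatureComponents (𝓡 5) e
    let τ := RiemGeom.scalarCurvature R
    (τ ^ 3 / 25 + τ / 5 * RiemGeom.curvatureNormSq R) * inner ℝ (e i) (e j)
      - 2 * τ * RiemGeom.curvatureSq R i j - 4 * RiemGeom.checkR R i j
      - 4 * RiemGeom.hatR R i j + 8 * RiemGeom.ringR R i j = 0 := by
  intro R τ
  obtain ⟨c, hc⟩ := hM
  rw [orthonormal_iff_ite.1 e.orthonormal i j]
  refine RiemGeom.cubic_einstein_identity (RiemGeom.isAlgCurvature_curvatureComponents e)
    (c := c) (fun k l ↦ ?_) i j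
  rw [RiemGeom.ricciComponents_curvatureComponents, hc, orthonormal_iff_ite.1 e.orthonormal k l]
  simp
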